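/- **Theorem (time reversibility 1).** Let $\mathcal A$ be a countable set of actions, $\mathcal R=\mathbb R_{>0}$ the set of rates, and $\mathcal K$ a countably infinite set of keys. *Standard forward processes* are $P ::= \underline 0 \mid \langle a,\lambda\rangle.P \mid P+P \mid P\parallel_L P$ with $a\in\mathcal A$, $\lambda\in\mathcal R$, $L\subseteq\mathcal A$; *reversible processes* are $R ::= P \mid \langle a,\lambda\rangle[i].R \mid R+R\mid R\parallel_L R$ with $i\in\mathcal K$. Write $\mathrm{std}(R)$ if $R$ is a standard forward process and $\mathrm{key}(R)$ for the set of keys occurring in $R$. Forward transitions $\rightarrow$ are generated by the rules * $\langle a,\lambda\rangle.R\xrightarrow{\langle a,\lambda\rangle[i]}\langle a,\lambda\rangle[i].R$ if $\mathrm{std}(R)$; * $\langle a,\lambda\rangle[i].R\xrightarrow{\langle b,\mu\rangle[j]}\langle a,\lambda\rangle[i].R'$ if $R\xrightarrow{\langle b,\mu\rangle[j]}R'$ and $j\ne i$; * $R+S\xrightarrow{\langle a,\lambda\rangle[i]}R'+S$ if $R\xrightarrow{\langle a,\lambda\rangle[i]}R'$ and $\mathrm{std}(S)$, and symmetrically;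 * $R\parallel_L S\xrightarrow{\langle a,\lambda\rangle[i]}R'\parallel_L S$ if $R\xrightarrow{\langle a,\lambda\rangle[i]}R'$, $a\notin L$ and $i\notin\mathrm{key}(S)$, and symmetrically; * $R\parallel_L S\xrightarrow{\langle a,\lambda\mu\rangle[i]}R'\parallel_L S'$ if $R\xrightarrow{\langle a,\lambda\rangle[i]}R'$, $S\xrightarrow{\langle a,\mu\rangle[i]}S'$ and $a\in L$. Every action $\langle a,\lambda\rangle$ has a backward rate $\overline\lambda\in\mathcal R$ (which may depend on $a$ and $\lambda$). Backward transitions $\dashrightarrow$ are generated by $\langle a,\lambda\rangle[i].R\overset{\langle a,\overline\lambda\rangle[i]}{\dashrightarrow}\langle a,\lambda\rangle.R$ if $\mathrm{std}(R)$, and by the same last four rules with $\dashrightarrow$ in place of $\rightarrow$ and backward rates in place of forward rates. A process is *reachable* if it is obtained from a standard forward process by finitely many forward transitions. Let $\equiv_{\mathcal K}$ be the smallest equivalence relation on reachable processes that relates $R$ to $S$ whenever $S$ is $R$ with all occurrences of one key replaced by a key not occurring in $R$. For a reachable process $R$, let $\mathcal M[\![R]\!]$ be the action-labeled CTMC with initial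 state $[R]_{\equiv_{\mathcal K}}$ whose transitions are $[S]\xrightarrow{\langle a,\lambda\rangle}[S']$ whenever $S$ and $S'$ are reachable and $S\xrightarrow{\langle a,\lambda\rangle[i]}S'$ or $S\overset{\langle a,\lambda\rangle[i]}{\dashrightarrow}S'$ for some $i\in\mathcal K$, and whose states are the classes that can be reached from $[R]_{\equiv_{\mathcal K}}$ by such transitions. For states $s\neq s'$ let $q_{s,s'}$ be the sum of the rates of the transitions from $s$ to $s'$, and let $q_{s,s}=-\sum_{s'\ne s}q_{s,s'}$. Suppose that every backward rate is equal to the corresponding forward rate, i.e. $\overline\lambda=\lambda$ for every action $\langle a,\lambda\rangle$. Then, for every reachable process $R$: 1. $\mathcal M[\![R]\!]$ has finitely many states and is irreducible. 2. With $n$ the number of its states, $\pi(s)=1/n$ is its unique steady-state distribution, i.e. the unique positive probability distribution with $\sum_s\pi(s)q_{s,s'}=0$ for all $s'$, and the partial balance equations $\pi(s)q_{s,s'}=\pi(s')q_{s',s}$ hold for all $s\ne s'$. 3. $\mathcal M[\![R]\!]$ is time reversible: there is a stationary time-homogeneous continuous-time Markov chain $(X(t))_{t\ge0}$ on its states in which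 the move from $s$ to $s'$ has rate $q_{s,s'}$, and for every such chain $(X(t_i))_{1\le i\le m}$ and $(X(t'-t_i))_{1\le i\le m}$ have the same joint distribution for all $m\ge1$, all $0\le t_1<\dots<t_m$ and all $t'\ge t_m$. -/

import Mathlib

open scoped NNReal
open Filter Topology MeasureTheory

universe u v w

namespace RMPC

/-! ### Syntax -/

/-- Rates are positive real numbers. -/
abbrev Rate : Type := {x : ℝ // 0 < x}

/-- Process terms: `nil`, unexecuted prefix `<a, r> . R`, executed prefix `<a, r>[i] . R`,
choice `R + S`, and parallel composition `R ∥_L S`. -/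
inductive Proc (Act : Type u) (Key : Type v) : Type (max u v)
  | nil : Proc Act Key
  | pre (a : Act) (r : Rate) (R : Proc Act Key) : Proc Act Key
  | past (a : Act) (r : Rate) (i : Key) (R : Proc Act Key) : Proc Act Key
  | cho (R S : Proc Act Key) : Proc Act Key
  | par (L : Set Act) (R S : Proc Act Key) : Proc Act Key

variable {Act : Type u} {Key : Type v}

namespace Proc

/-- Standard forward processes: no prefix has been executed. -/
def Std : Proc Act Key → Prop
  | nil => True
  | pre _ _ R => Std R
  | past _ _ _ _ => False
  | cho R S => Std R ∧ Std S
  | par _ R S => Std R ∧ Std S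

/-- The set of keys that occur in a process. -/
def keys : Proc Act Key → Set Key
  | nil => ∅
  | pre _ _ R => keys R
  | past _ _ i R => {i} ∪ keys R
  | cho R S => keys R ∪ keys S
  | par _ R S => keys R ∪ keys S

/-- Apply a function to every key of a process. -/
def mapKeys (f : Key → Key) : Proc Act Key → Proc Act Key
  | nil => nil
  | pre a r R => pre a r (mapKeys f R)
  | past a r i R => past a r (f i) (mapKeys f R)
  | cho R S => cho (mapKeys f R) (mapKeys f S)
  | par L R S => par L (mapKeys f R) (mapKeys f S)

open Classical in
/-- Replace all occurrences of the key `i` by `j`. -/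
noncomputable def rename (i j : Key) (R : Proc Act Key) : Proc Act Key :=
  mapKeys (fun k => if k = i then j else k) R

end Proc

open Proc

/-! ### Operational semantics -/

/-- Forward transitions: `Fw R a r i S` is `R --<a, r>[i]--> S`. -/
inductive Fw : Proc Act Key → Act → Rate → Key → Proc Act Key → Prop
  | act1 {a : Act} {r : Rate} {i : Key} {R : Proc Act Key} :
      Std R → Fw (pre a r R) a r i (past a r i R)
  | act2 {a b : Act} {r m : Rate} {i j : Key} {R R' : Proc Act Key} :
      Fw R b m j R' → j ≠ i → Fw (past a r i R) b m j (past a r i R')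
  | choL {a : Act} {r : Rate} {i : Key} {R R' S : Proc Act Key} :
      Fw R a r i R' → Std S → Fw (cho R S) a r i (cho R' S)
  | choR {a : Act} {r : Rate} {i : Key} {R S S' : Proc Act Key} :
      Fw S a r i S' → Std R → Fw (cho R S) a r i (cho R S')
  | parL {a : Act} {r : Rate} {i : Key} {L : Set Act} {R R' S : Proc Act Key} :
      Fw R a r i R' → a ∉ L → i ∉ keys S → Fw (par L R S) a r i (par L R' S)
  | parR {a : Act} {r : Rate} {i : Key} {L : Set Act} {R S S' : Proc Act Key} :
      Fw S a r i S' → a ∉ L → i ∉ keys R → Fw (par L R S) a r i (par L R S')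
  | coo {a : Act} {r m : Rate} {i : Key} {L : Set Act} {R R' S S' : Proc Act Key} :
      Fw R a r i R' → Fw S a m i S' → a ∈ L → Fw (par L R S) a (r * m) i (par L R' S')

/-- Backward transitions, where `bar a r` is the rate at which the action `<a, r>` is undone:
`Bk bar R a r i S` is `R --<a, r>[i]--> S` in the backward direction, `r` being the rate in the
backward label. -/
inductive Bk (bar : Act → Rate → Rate) :
    Proc Act Key → Act → Rate → Key → Proc Act Key → Prop
  | act1 {a : Act} {r : Rate} {i : Key} {R : Proc Act Key} :
      Std R → Bk bar (past a r i R) a (bar a r) i (pre a r R)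
  | act2 {a b : Act} {r m : Rate} {i j : Key} {R R' : Proc Act Key} :
      Bk bar R b m j R' → j ≠ i → Bk bar (past a r i R) b m j (past a r i R')
  | choL {a : Act} {r : Rate} {i : Key} {R R' S : Proc Act Key} :
      Bk bar R a r i R' → Std S → Bk bar (cho R S) a r i (cho R' S)
  | choR {a : Act} {r : Rate} {i : Key} {R S S' : Proc Act Key} :
      Bk bar S a r i S' → Std R → Bk bar (cho R S) a r i (cho R S')
  | parL {a : Act} {r : Rate} {i : Key} {L : Set Act} {R R' S : Proc Act Key} :
      Bk bar R a r i R' → a ∉ L → i ∉ keys S → Bk bar (par L R S) a r i (par L R' S)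
  | parR {a : Act} {r : Rate} {i : Key} {L : Set Act} {R S S' : Proc Act Key} :
      Bk bar S a r i S' → a ∉ L → i ∉ keys R → Bk bar (par L R S) a r i (par L R S')
  | coo {a : Act} {r m : Rate} {i : Key} {L : Set Act} {R R' S S' : Proc Act Key} :
      Bk bar R a r i R' → Bk bar S a m i S' → a ∈ L →
        Bk bar (par L R S) a (r * m) i (par L R' S')

/-- Reachable processes: obtained from a standard forward process by finitely many forward
transitions. -/
def Reachable (R : Proc Act Key) : Prop :=
  ∃ P : Proc Act Key, Std P ∧
    Relation.ReflTransGen (fun S S' => ∃ a r i, Fw S a r i S') P R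

/-- The type of reachable processes. -/
abbrev RProc (Act : Type u) (Key : Type v) : Type (max u v) :=
  {R : Proc Act Key // Reachable R}

/-! ### The underlying CTMC -/

/-- One step of key replacement: all occurrences of one key are replaced by a key that does not
occur in the process. In a reachable process the occurrences of a key are exactly the prefixes
that were executed together by one (possibly synchronized) transition. -/
def KeyStep (R S : RProc Act Key) : Prop :=
  ∃ i j : Key, j ∉ keys R.1 ∧ S.1 = rename i j R.1

/-- Equality up to keys: the smallest equivalence relation on reachable processes that
contains `KeyStep`. -/
def keySetoid (Act : Type u) (Key : Type v) : Setoid (RProc Act Key) :=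
  Relation.EqvGen.setoid KeyStep

/-- Classes of reachable processes that are equal up to keys. -/
abbrev KClass (Act : Type u) (Key : Type v) : Type (max u v) :=
  Quotient (keySetoid Act Key)

/-- The class of a reachable process. -/
def cls (R : RProc Act Key) : KClass Act Key := Quotient.mk (keySetoid Act Key) R

/-- Forward transitions between classes. -/
def FwK (s : KClass Act Key) (l : Act × Rate) (s' : KClass Act Key) : Prop :=
  ∃ S S' : RProc Act Key, cls S = s ∧ cls S' = s' ∧ ∃ i : Key, Fw S.1 l.1 l.2 i S'.1

/-- Backward transitions between classes. -/
def BkK (bar : Act → Rate → Rate) (s : KClass Act Key) (l : Act × Rate)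
    (s' : KClass Act Key) : Prop :=
  ∃ S S' : RProc Act Key, cls S = s ∧ cls S' = s' ∧ ∃ i : Key, Bk bar S.1 l.1 l.2 i S'.1

/-- The transition relation of the underlying CTMC. -/
def TransK (bar : Act → Rate → Rate) (s : KClass Act Key) (l : Act × Rate)
    (s' : KClass Act Key) : Prop :=
  FwK s l s' ∨ BkK bar s l s'

/-- The states of the CTMC underlying `R`: the classes that can be reached from the initial
state, i.e. from the class of `R`. -/
abbrev State (bar : Act → Rate → Rate) (R : RProc Act Key) : Type (max u v) :=
  {s : KClass Act Key //
    Relation.ReflTransGen (fun x y => ∃ l, TransK bar x l y) (cls R) s}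

/-- The rate at which the CTMC underlying `R` moves from `s` to `s'`: the sum of the rates of
the transitions from `s` to `s'`. -/
noncomputable def rate (bar : Act → Rate → Rate) (R : RProc Act Key)
    (s s' : State bar R) : ℝ :=
  ∑ᶠ (l : Act × Rate) (_ : TransK bar s.1 l s'.1), (l.2 : ℝ)

end RMPC

/-! ### Continuous-time Markov chains -/

namespace CTMC

variable {S : Type u}

open Classical in
/-- The infinitesimal generator matrix given by the rates `q`. -/
noncomputable def generator (q : S → S → ℝ) (s s' : S) : ℝ :=
  if s = s' then - ∑ᶠ (x : S) (_ : x ≠ s), q s x else q s s'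

/-- Every state can be reached from every other one. -/
def Irreducible (q : S → S → ℝ) : Prop :=
  ∀ s s' : S, Relation.ReflTransGen (fun x y => 0 < q x y) s s'

/-- `p` is a positive probability distribution that solves the global balance equations. -/
def IsSteadyState (q : S → S → ℝ) (p : S → ℝ) : Prop :=
  (∀ s, 0 < p s) ∧ HasSum p 1 ∧ ∀ s', HasSum (fun s => p s * generator q s s') 0

/-- The probability of `X (t + h) = s'` given `X t = s`. -/
noncomputable def transProb {Ω : Type w} [MeasurableSpace Ω] (μ : Measure Ω)
    (X : ℝ≥0 → Ω → S) (t h : ℝ≥0) (s s' : S) : ℝ :=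
  (ProbabilityTheory.cond μ {ω | X t ω = s}).real {ω | X (t + h) ω = s'}

open Classical in
/-- `X` is a time-homogeneous continuous-time Markov chain on `S` in which the move from `s` to
`s'` has rate `q s s'`. -/
structure IsCTMC {Ω : Type w} [MeasurableSpace Ω] (μ : Measure Ω) (X : ℝ≥0 → Ω → S)
    (q : S → S → ℝ) : Prop where
  prob : IsProbabilityMeasure μ
  measurableSet_eq : ∀ t s, MeasurableSet {ω | X t ω = s}
  markov : ∀ (n : ℕ) (t : Fin (n + 2) → ℝ≥0) (s : Fin (n + 2) → S), StrictMono t →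
    μ {ω | ∀ i : Fin (n + 1), X (t i.castSucc) ω = s i.castSucc} ≠ 0 →
    (ProbabilityTheory.cond μ {ω | ∀ i : Fin (n + 1), X (t i.castSucc) ω = s i.castSucc}).real
        {ω | X (t (Fin.last (n + 1))) ω = s (Fin.last (n + 1))} =
      (ProbabilityTheory.cond μ
          {ω | X (t (Fin.last n).castSucc) ω = s (Fin.last n).castSucc}).real
        {ω | X (t (Fin.last (n + 1))) ω = s (Fin.last (n + 1))}
  homogeneous : ∀ (t t' h : ℝ≥0) (s s' : S), μ {ω | X t ω = s} ≠ 0 → μ {ω | X t' ω = s} ≠ 0 →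
    transProb μ X t h s s' = transProb μ X t' h s s'
  rates : ∀ (t : ℝ≥0) (s s' : S), μ {ω | X t ω = s} ≠ 0 →
    Tendsto (fun h : ℝ≥0 => (transProb μ X t h s s' - if s = s' then 1 else 0) / (h : ℝ))
      (𝓝[>] 0) (𝓝 (generator q s s'))

/-- Stationarity: joint distributions (of discrete variables, hence given by their point
probabilities) are invariant under time shifts. -/
def IsStationary {Ω : Type w} [MeasurableSpace Ω] (μ : Measure Ω) (X : ℝ≥0 → Ω → S) : Prop :=
  ∀ (n : ℕ) (t : Fin n → ℝ≥0) (t' : ℝ≥0) (s : Fin n → S), StrictMono t →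
    μ {ω | ∀ i, X (t i + t') ω = s i} = μ {ω | ∀ i, X (t i) ω = s i}

/-- Time reversibility of a process: joint distributions are invariant under the reversal
`t ↦ t' - t` of time, for all times at which the reversed instants are defined. -/
def IsReversible {Ω : Type w} [MeasurableSpace Ω] (μ : Measure Ω) (X : ℝ≥0 → Ω → S) : Prop :=
  ∀ (n : ℕ) (t : Fin n → ℝ≥0) (t' : ℝ≥0) (s : Fin n → S), StrictMono t → (∀ i, t i ≤ t') →
    μ {ω | ∀ i, X (t i) ω = s i} = μ {ω | ∀ i, X (t' - t i) ω = s i}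

/-- The CTMC with rates `q` is time reversible: it exists as a stationary process, and every
stationary CTMC with these rates is a time reversible process. -/
def TimeReversible (q : S → S → ℝ) : Prop :=
  (∃ (Ω : Type) (_ : MeasurableSpace Ω) (μ : Measure Ω) (X : ℝ≥0 → Ω → S),
    IsCTMC μ X q ∧ IsStationary μ X) ∧
  ∀ (Ω : Type w) [MeasurableSpace Ω] (μ : Measure Ω) (X : ℝ≥0 → Ω → S),
    IsCTMC μ X q → IsStationary μ X → IsReversible μ X

end CTMC

/-! When backward rates equal forward rates, a backward transition is a forward transition read from
right to left (`bk_iff_fw`), so the rates between classes are symmetric; everything else follows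
from this symmetry.

Finiteness: transitions in either direction preserve the process obtained by forgetting executions.
A process has at most `size` keys, so up to renaming all its keys lie in one fixed finite set, which
leaves finitely many processes with a given erasure. Irreducibility: every state is reached from the
initial one, and by symmetry every path can be run backwards.

Steady state: a symmetric generator `Q` has vanishing column sums, so the uniform distribution
solves `p Q = 0`. Conversely `p Q = 0` means `Q p = 0`, and the maximum principle forces `p` to be
constant.

Reversibility: stationarity, differentiated at time zero, gives `p Q = 0`, so the marginals are
uniform. The finite-dimensional laws are then products of transition probabilities `P`, and
reversing time transposes each factor. `P` is a doubly stochastic semigroup with symmetric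
derivative at zero; the bound `‖P u - (P u)ᵀ‖ ≤ n ‖P (u/n) - (P (u/n))ᵀ‖`, whose right side is `n ·
o(u/n)`, shows that `P` is symmetric. Existence comes from `exp (u Q)` and Kolmogorov's extension
theorem. -/

namespace RMPC

variable {Act : Type u} {Key : Type v}

/-! ### Erasure, size, labels and keys of processes -/

namespace Proc

/-- The standard process obtained by forgetting which prefixes have been executed. -/
def erase : Proc Act Key → Proc Act Key
  | nil => nil
  | pre a r R => pre a r (erase R)
  | past a r _ R => pre a r (erase R)
  | cho R S => cho (erase R) (erase S)
  | par L R S => par L (erase R) (erase S)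

/-- The number of prefixes of a process. -/
def size : Proc Act Key → ℕ
  | nil => 0
  | pre _ _ R => size R + 1
  | past _ _ _ R => size R + 1
  | cho R S => size R + size S
  | par _ R S => size R + size S

/-- A bound on the labels of the forward transitions of a process. -/
def labels : Proc Act Key → Set (Act × Rate)
  | nil => ∅
  | pre a r R => insert (a, r) (labels R)
  | past a r _ R => insert (a, r) (labels R)
  | cho R S => labels R ∪ labels S
  | par _ R S => labels R ∪ labels S ∪
      Set.image2 (fun l m => (l.1, l.2 * m.2)) (labels R) (labels S)

theorem labels_finite (R : Proc Act Key) : (labels R).Finite := by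
  induction R with
  | nil => exact Set.finite_empty
  | pre a r R ih => exact ih.insert _
  | past a r i R ih => exact ih.insert _
  | cho R S ihR ihS => exact ihR.union ihS
  | par L R S ihR ihS => exact (ihR.union ihS).union (ihR.image2 _ ihS)

theorem labels_erase (R : Proc Act Key) : labels (erase R) = labels R := by
  induction R <;> simp_all [erase, labels]

theorem size_erase (R : Proc Act Key) : size (erase R) = size R := by
  induction R <;> simp_all [erase, size]

theorem erase_mapKeys (f : Key → Key) (R : Proc Act Key) : erase (mapKeys f R) = erase R := by
  induction R <;> simp_all [erase, mapKeys]

theorem keys_mapKeys (f : Key → Key) (R : Proc Act Key) : keys (mapKeys f R) = f '' keys R := by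
  induction R <;> simp_all [keys, mapKeys, Set.image_union, Set.image_insert_eq]

theorem std_mapKeys (f : Key → Key) (R : Proc Act Key) : Std (mapKeys f R) ↔ Std R := by
  induction R <;> simp_all [Std, mapKeys]

theorem mapKeys_congr {f g : Key → Key} (R : Proc Act Key) (h : ∀ k ∈ keys R, f k = g k) :
    mapKeys f R = mapKeys g R := by
  induction R with
  | nil => rfl
  | pre a r R ih => simp [mapKeys, ih h]
  | past a r i R ih =>
    simp [mapKeys, ih fun k hk => h k (Or.inr hk), h i (Or.inl rfl)]
  | cho R S ihR ihS =>
    simp [mapKeys, ihR fun k hk => h k (Or.inl hk), ihS fun k hk => h k (Or.inr hk)]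
  | par L R S ihR ihS =>
    simp [mapKeys, ihR fun k hk => h k (Or.inl hk), ihS fun k hk => h k (Or.inr hk)]

theorem keys_finite (R : Proc Act Key) : (keys R).Finite := by
  induction R with
  | nil => exact Set.finite_empty
  | pre a r R ih => exact ih
  | past a r i R ih => exact (Set.finite_singleton i).union ih
  | cho R S ihR ihS => exact ihR.union ihS
  | par L R S ihR ihS => exact ihR.union ihS

theorem ncard_keys_le (R : Proc Act Key) : (keys R).ncard ≤ size R := by
  induction R with
  | nil => simp [keys]
  | pre a r R ih => exact ih.trans (Nat.le_succ _)
  | past a r i R ih =>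
    refine (Set.ncard_union_le _ _).trans ?_
    rw [Set.ncard_singleton, size, add_comm]
    exact Nat.add_le_add_right ih 1
  | cho R S ihR ihS => exact (Set.ncard_union_le _ _).trans (Nat.add_le_add ihR ihS)
  | par L R S ihR ihS => exact (Set.ncard_union_le _ _).trans (Nat.add_le_add ihR ihS)

/-- Finitely many processes with keys in a finite set have the same underlying standard process. -/
theorem finite_erase_eq {T : Set Key} (hT : T.Finite) (P : Proc Act Key) :
    {R : Proc Act Key | erase R = P ∧ keys R ⊆ T}.Finite := by
  induction P with
  | nil =>
    refine (Set.finite_singleton nil).subset ?_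
    rintro (_ | _ | _ | _ | _) ⟨h, -⟩ <;> simp_all [erase]
  | pre a r P ih =>
    refine ((ih.image (pre a r)).union (hT.image2 (past a r) ih)).subset ?_
    rintro (_ | ⟨b, m, R⟩ | ⟨b, m, i, R⟩ | _ | _) ⟨h, hk⟩ <;> simp only [erase, reduceCtorEq] at h
    · obtain ⟨rfl, rfl, hR⟩ := Proc.pre.inj h
      exact Or.inl ⟨R, ⟨hR, hk⟩, rfl⟩
    · obtain ⟨rfl, rfl, hR⟩ := Proc.pre.inj h
      exact Or.inr ⟨i, hk (Or.inl rfl), R, ⟨hR, fun k hk' => hk (Or.inr hk')⟩, rfl⟩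
  | past a r i P ih =>
    refine Set.finite_empty.subset ?_
    rintro (_ | _ | _ | _ | _) ⟨h, -⟩ <;> simp [erase] at h
  | cho P Q ihP ihQ =>
    refine (ihP.image2 cho ihQ).subset ?_
    rintro (_ | _ | _ | ⟨R, S⟩ | _) ⟨h, hk⟩ <;> simp only [erase, reduceCtorEq] at h
    obtain ⟨hR, hS⟩ := Proc.cho.inj h
    exact ⟨R, ⟨hR, fun k hk' => hk (Or.inl hk')⟩, S, ⟨hS, fun k hk' => hk (Or.inr hk')⟩, rfl⟩
  | par L P Q ihP ihQ =>
    refine (ihP.image2 (par L) ihQ).subset ?_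
    rintro (_ | _ | _ | _ | ⟨M, R, S⟩) ⟨h, hk⟩ <;> simp only [erase, reduceCtorEq] at h
    obtain ⟨rfl, hR, hS⟩ := Proc.par.inj h
    exact ⟨R, ⟨hR, fun k hk' => hk (Or.inl hk')⟩, S, ⟨hS, fun k hk' => hk (Or.inr hk')⟩, rfl⟩

theorem Std.mapKeys_eq {R : Proc Act Key} (h : Std R) (f : Key → Key) : mapKeys f R = R := by
  induction R <;> simp_all [Std, mapKeys]

-- Replacing `i` by a fresh `j` is not injective on all keys, but on the keys of `R` it agrees with
-- a transposition, so results about injective renamings apply.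
open Classical in
theorem rename_eq_mapKeys_swap {i j : Key} {R : Proc Act Key} (hj : j ∉ keys R) :
    rename i j R = mapKeys (Equiv.swap i j) R := by
  refine mapKeys_congr R fun k hk => ?_
  have : k ≠ j := fun h => hj (h ▸ hk)
  rw [Equiv.swap_apply_def]
  simp [this]

theorem keys_rename (i j : Key) (R : Proc Act Key) (hi : i ∈ keys R) :
    keys (rename i j R) = insert j (keys R \ {i}) := by
  rw [rename, keys_mapKeys]
  ext k
  simp only [Set.mem_image, Set.mem_insert_iff, Set.mem_sdiff, Set.mem_singleton_iff]
  constructor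
  · rintro ⟨x, hx, rfl⟩
    split_ifs with h
    · exact Or.inl rfl
    · exact Or.inr ⟨hx, h⟩
  · rintro (rfl | ⟨hk, hki⟩)
    · exact ⟨i, hi, if_pos rfl⟩
    · exact ⟨k, hk, if_neg hki⟩

end Proc

open Proc

/-! ### Transitions: erasure, renaming and reversal -/

theorem Fw.erase_eq {R S : Proc Act Key} {a : Act} {r : Rate} {i : Key} (h : Fw R a r i S) :
    erase S = erase R := by
  induction h <;> simp_all [erase]

theorem Fw.mem_labels {R S : Proc Act Key} {a : Act} {r : Rate} {i : Key} (h : Fw R a r i S) :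
    (a, r) ∈ labels R := by
  induction h with
  | act1 _ => exact Or.inl rfl
  | act2 _ _ ih => exact Or.inr ih
  | choL _ _ ih => exact Or.inl ih
  | choR _ _ ih => exact Or.inr ih
  | parL _ _ _ ih => exact Or.inl (Or.inl ih)
  | parR _ _ _ ih => exact Or.inl (Or.inr ih)
  | coo _ _ _ ih ih' => exact Or.inr ⟨_, ih, _, ih', rfl⟩

/-- Injectivity preserves the side conditions of the rules, which say that a key differs from
another one or is absent. -/
theorem Fw.mapKeys {R S : Proc Act Key} {a : Act} {r : Rate} {i : Key} {f : Key → Key}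
    (hf : f.Injective) (h : Fw R a r i S) :
    Fw (R.mapKeys f) a r (f i) (S.mapKeys f) := by
  induction h with
  | act1 h => exact .act1 ((std_mapKeys _ _).2 h)
  | act2 _ hij ih => exact .act2 ih (hf.ne hij)
  | choL _ h ih => exact .choL ih ((std_mapKeys _ _).2 h)
  | choR _ h ih => exact .choR ih ((std_mapKeys _ _).2 h)
  | parL _ ha hi ih => exact .parL ih ha (by rwa [keys_mapKeys, hf.mem_set_image])
  | parR _ ha hi ih => exact .parR ih ha (by rwa [keys_mapKeys, hf.mem_set_image])
  | coo _ _ ha ihR ihS => exact .coo ihR ihS ha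

theorem Reachable.mapKeys {R : Proc Act Key} {f : Key → Key} (hf : f.Injective)
    (h : Reachable R) : Reachable (R.mapKeys f) := by
  obtain ⟨P, hP, hR⟩ := h
  refine ⟨P, hP, ?_⟩
  rw [← hP.mapKeys_eq f]
  exact hR.lift _ fun S S' ⟨a, r, i, hS⟩ => ⟨a, r, f i, hS.mapKeys hf⟩

/-- If backward rates are equal to forward rates, then backward transitions are exactly the
reversed forward transitions. -/
theorem bk_iff_fw {bar : Act → Rate → Rate} (hbar : ∀ a r, bar a r = r) {R S : Proc Act Key}
    {a : Act} {r : Rate} {i : Key} : Bk bar R a r i S ↔ Fw S a r i R := by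
  constructor
  · intro h
    induction h with
    | act1 h => rw [hbar]; exact .act1 h
    | act2 _ hij ih => exact .act2 ih hij
    | choL _ h ih => exact .choL ih h
    | choR _ h ih => exact .choR ih h
    | parL _ ha hi ih => exact .parL ih ha hi
    | parR _ ha hi ih => exact .parR ih ha hi
    | coo _ _ ha ihR ihS => exact .coo ihR ihS ha
  · intro h
    induction h with
    | @act1 a r i R h => simpa only [hbar] using Bk.act1 (bar := bar) (a := a) (r := r) (i := i) h
    | act2 _ hij ih => exact .act2 ih hij
    | choL _ h ih => exact .choL ih h
    | choR _ h ih => exact .choR ih h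
    | parL _ ha hi ih => exact .parL ih ha hi
    | parR _ ha hi ih => exact .parR ih ha hi
    | coo _ _ ha ihR ihS => exact .coo ihR ihS ha

/-! ### Classes up to keys -/

/-- The standard process underlying a class of processes. -/
def KClass.erase : KClass Act Key → Proc Act Key :=
  Quotient.lift (fun R => Proc.erase R.1) fun R S h => by
    induction h with
    | rel R S h =>
      obtain ⟨i, j, -, h⟩ := h
      rw [h, rename, erase_mapKeys]
    | refl R => rfl
    | symm R S _ ih => exact ih.symm
    | trans R S T _ _ ih ih' => exact ih.trans ih'

theorem KClass.erase_cls (R : RProc Act Key) : KClass.erase (cls R) = Proc.erase R.1 := rfl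

/-- Every class has a representative whose keys belong to a given set that is large enough. -/
theorem exists_cls_eq_keys_subset (T : Finset Key) (R : RProc Act Key)
    (hT : (keys R.1).ncard ≤ T.card) : ∃ S : RProc Act Key, cls S = cls R ∧ keys S.1 ⊆ T := by
  classical
  -- Induction on the number of keys outside `T`; each step trades one of them for an unused key of
  -- `T`.
  induction hn : (keys R.1 \ (T : Set Key)).ncard generalizing R with
  | zero =>
    refine ⟨R, rfl, ?_⟩
    rwa [Set.ncard_eq_zero ((keys_finite _).sdiff), Set.sdiff_eq_empty] at hn
  | succ n ih =>
    have hfin := keys_finite R.1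
    obtain ⟨i, hi, hiT⟩ : (keys R.1 \ (T : Set Key)).Nonempty :=
      Set.nonempty_of_ncard_ne_zero (by omega)
    -- If all of `T` were used, then `T` together with `i ∉ T` would give more keys than `hT`
    -- allows.
    obtain ⟨j, hjT, hj⟩ : ∃ j ∈ (T : Set Key), j ∉ keys R.1 := by
      by_contra! h
      have : insert i (T : Set Key) ⊆ keys R.1 := Set.insert_subset hi h
      have := Set.ncard_le_ncard this hfin
      rw [Set.ncard_insert_of_notMem hiT T.finite_toSet, Set.ncard_coe_finset] at this
      omega
    have hk := keys_rename i j R.1 hi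
    obtain ⟨S, hS, hST⟩ := ih ⟨rename i j R.1, by
        rw [rename_eq_mapKeys_swap hj]
        exact R.2.mapKeys (Equiv.injective _)⟩
      (by
        rw [hk, Set.ncard_insert_of_notMem (fun h => hj h.1) hfin.sdiff]
        have := Set.ncard_sdiff_singleton_add_one hi hfin
        omega)
      (by
        rw [hk, Set.insert_sdiff_of_mem _ hjT]
        have : (keys R.1 \ {i}) \ (T : Set Key) = (keys R.1 \ (T : Set Key)) \ {i} := by
          ext; simp; tauto
        rw [this]
        have := Set.ncard_sdiff_singleton_add_one (s := keys R.1 \ (T : Set Key)) ⟨hi, hiT⟩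
          hfin.sdiff
        omega)
    refine ⟨S, hS.trans (Quotient.sound (Relation.EqvGen.symm _ _ (.rel _ _ ?_))), hST⟩
    exact ⟨i, j, hj, rfl⟩

/-- One set `T` of `size P` keys serves all classes over `P`, so they are images of the finitely
many processes over `P` with keys in `T`. -/
theorem finite_erase_eq [Infinite Key] (P : Proc Act Key) :
    {s : KClass Act Key | KClass.erase s = P}.Finite := by
  obtain ⟨T, hT⟩ := Infinite.exists_subset_card_eq Key (size P)
  refine (((Proc.finite_erase_eq T.finite_toSet P).preimage
    Subtype.val_injective.injOn).image cls).subset ?_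
  intro s hs
  induction s using Quotient.inductionOn with
  | h R =>
    have hR : Proc.erase R.1 = P := hs
    obtain ⟨S, hS, hST⟩ := exists_cls_eq_keys_subset T R (by
      rw [hT, ← hR, size_erase]
      exact ncard_keys_le _)
    refine ⟨S, ⟨?_, hST⟩, hS⟩
    rw [← KClass.erase_cls, hS]
    exact hs

/-! ### Symmetry of the rates, finiteness and irreducibility -/

section Symmetric

variable {bar : Act → Rate → Rate}

theorem bkK_iff_fwK (hbar : ∀ a r, bar a r = r) {s s' : KClass Act Key} {l : Act × Rate} :
    BkK bar s l s' ↔ FwK s' l s := by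
  simp only [BkK, FwK, bk_iff_fw hbar]
  constructor <;> rintro ⟨S, S', h, h', i, hi⟩ <;> exact ⟨S', S, h', h, i, hi⟩

theorem transK_comm (hbar : ∀ a r, bar a r = r) {s s' : KClass Act Key} {l : Act × Rate} :
    TransK bar s l s' ↔ TransK bar s' l s := by
  rw [TransK, TransK, bkK_iff_fwK hbar, bkK_iff_fwK hbar, or_comm]

theorem FwK.erase_eq {s s' : KClass Act Key} {l : Act × Rate} (h : FwK s l s') :
    s'.erase = s.erase := by
  obtain ⟨S, S', rfl, rfl, i, h⟩ := h
  exact h.erase_eq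

theorem TransK.erase_eq (hbar : ∀ a r, bar a r = r) {s s' : KClass Act Key} {l : Act × Rate}
    (h : TransK bar s l s') : s'.erase = s.erase := by
  rcases h with h | h
  · exact h.erase_eq
  · exact ((bkK_iff_fwK hbar).1 h).erase_eq.symm

/-- A `finsum` with infinite support is zero by convention. Finiteness makes `rate` a genuine sum,
hence positive as soon as there is a transition. -/
theorem finite_transK (hbar : ∀ a r, bar a r = r) (s s' : KClass Act Key) :
    {l | TransK bar s l s'}.Finite := by
  have key : ∀ {s s' : KClass Act Key} {l}, FwK s l s' → l ∈ labels s.erase := by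
    rintro _ _ l ⟨S, S', rfl, rfl, i, h⟩
    rw [KClass.erase_cls, labels_erase]
    exact h.mem_labels
  refine ((labels_finite s.erase).union (labels_finite s'.erase)).subset ?_
  rintro l (h | h)
  · exact Or.inl (key h)
  · exact Or.inr (key ((bkK_iff_fwK hbar).1 h))

theorem finite_state [Infinite Key] (hbar : ∀ a r, bar a r = r) (R : RProc Act Key) :
    Finite (State bar R) := by
  refine Set.Finite.to_subtype ((finite_erase_eq (Proc.erase R.1)).subset ?_)
  intro s hs
  induction hs with
  | refl => rfl
  | tail _ h ih =>
    obtain ⟨l, h⟩ := h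
    exact (h.erase_eq hbar).trans ih

theorem rate_comm (hbar : ∀ a r, bar a r = r) (R : RProc Act Key) (s s' : State bar R) :
    rate bar R s s' = rate bar R s' s := by
  simp only [rate, transK_comm hbar (s := s.1)]

theorem rate_nonneg (R : RProc Act Key) (s s' : State bar R) : 0 ≤ rate bar R s s' :=
  finsum_nonneg fun l => finsum_nonneg fun _ => l.2.2.le

theorem rate_pos (hbar : ∀ a r, bar a r = r) (R : RProc Act Key)
    {s s' : State bar R} {l : Act × Rate} (h : TransK bar s.1 l s'.1) : 0 < rate bar R s s' := by
  have hfin := finite_transK hbar s.1 s'.1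
  have hsum : rate bar R s s' = ∑ l ∈ hfin.toFinset, (l.2 : ℝ) :=
    finsum_mem_eq_finite_toFinset_sum _ hfin
  rw [hsum]
  exact Finset.sum_pos (fun l _ => l.2.2) ⟨l, by simpa using h⟩

/-- Any two states are joined through the initial one: a path from it to `s` is reversed, then a
path to `s'` is followed. -/
theorem irreducible_rate (hbar : ∀ a r, bar a r = r) (R : RProc Act Key) :
    CTMC.Irreducible (rate bar R) := by
  set rel : State bar R → State bar R → Prop := fun x y => 0 < rate bar R x y
  have : _root_.Std.Symm rel := ⟨fun x y h => by
    have : 0 < rate bar R x y := h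
    rwa [rate_comm hbar] at this⟩
  have key : ∀ s : State bar R, Relation.ReflTransGen rel ⟨cls R, .refl⟩ s := by
    rintro ⟨s, hs⟩
    induction hs with
    | refl => exact .refl
    | tail hs h ih =>
      obtain ⟨l, h⟩ := h
      exact ih.tail (rate_pos hbar R h)
  intro s s'
  refine Relation.ReflTransGen.trans ?_ (key s')
  exact (Relation.ReflTransGen.stdSymm (r := rel)).symm _ _ (key s)

end Symmetric

end RMPC

/-! ### Generators and the steady state -/

namespace CTMC

variable {S : Type u}

section Generator

variable {q : S → S → ℝ}

theorem generator_of_ne {s s' : S} (h : s ≠ s') : generator q s s' = q s s' := if_neg h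

open Classical in
theorem generator_self [Fintype S] (s : S) :
    generator q s s = -∑ x ∈ Finset.univ.erase s, q s x := by
  rw [generator, if_pos rfl, ← finsum_mem_coe_finset]
  simp

theorem sum_generator [Fintype S] (s : S) : ∑ s', generator q s s' = 0 := by
  classical
  rw [← Finset.add_sum_erase _ _ (Finset.mem_univ s), generator_self, neg_add_eq_zero]
  exact Finset.sum_congr rfl fun x hx => (generator_of_ne (Finset.ne_of_mem_erase hx).symm).symm

theorem generator_comm (hq : ∀ s s', q s s' = q s' s) (s s' : S) :
    generator q s s' = generator q s' s := by
  rcases eq_or_ne s s' with rfl | h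
  · rfl
  · rw [generator_of_ne h, generator_of_ne h.symm, hq]

/-- Harmonic functions of an irreducible finite chain are constant. -/
theorem Irreducible.eq_of_sum_generator_mul_eq_zero [Fintype S] (hirr : Irreducible q)
    (hq : ∀ s s', 0 ≤ q s s') {v : S → ℝ} (hv : ∀ s, ∑ s', generator q s s' * v s' = 0)
    (s s' : S) : v s = v s' := by
  -- Maximum principle: the maximal value propagates from `m` along positive rates, hence
  -- everywhere.
  obtain ⟨m, -, hm⟩ := Finset.exists_max_image Finset.univ v ⟨s, Finset.mem_univ s⟩
  suffices h : ∀ x, v x = v m from (h s).trans (h s').symm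
  intro x
  induction hirr m x with
  | refl => rfl
  | @tail y z _ hyz ih =>
    -- Rows of the generator sum to zero, so `v y` may be subtracted. At a maximum all terms are
    -- nonpositive, so each of them vanishes.
    have hsum : ∑ s', generator q y s' * (v s' - v y) = 0 := by
      simp_rw [mul_sub, Finset.sum_sub_distrib, ← Finset.sum_mul, hv, sum_generator]
      simp
    have hle : ∀ s' ∈ Finset.univ, generator q y s' * (v s' - v y) ≤ 0 := by
      intro s' hs'
      rcases eq_or_ne y s' with rfl | h
      · simp
      · rw [generator_of_ne h]
        exact mul_nonpos_of_nonneg_of_nonpos (hq _ _) (by rw [ih]; linarith [hm s' hs'])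
    have hz := (Finset.sum_eq_zero_iff_of_nonpos hle).1 hsum z (Finset.mem_univ z)
    rcases eq_or_ne y z with rfl | h
    · exact ih
    · rw [generator_of_ne h, mul_eq_zero, or_iff_right hyz.ne'] at hz
      linarith

/-- By symmetry of the generator, a solution of the balance equations is also a harmonic function.
-/
theorem Irreducible.eq_inv_card [Fintype S] [Nonempty S] (hirr : Irreducible q)
    (hq : ∀ s s', 0 ≤ q s s') (hsymm : ∀ s s', q s s' = q s' s) {p : S → ℝ}
    (hp : ∀ s', ∑ s, p s * generator q s s' = 0) (hsum : ∑ s, p s = 1) (s : S) :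
    p s = (Fintype.card S : ℝ)⁻¹ := by
  have hconst := hirr.eq_of_sum_generator_mul_eq_zero hq (v := p) fun s' => by
    rw [← hp s']
    exact Finset.sum_congr rfl fun x _ => by rw [generator_comm hsymm, mul_comm]
  have : ∑ x, p x = ∑ _x : S, p s := Finset.sum_congr rfl fun x _ => hconst x s
  rw [hsum, Finset.sum_const, Finset.card_univ, nsmul_eq_mul] at this
  exact eq_inv_of_mul_eq_one_right this.symm

theorem Irreducible.isSteadyState_iff [Finite S] [Nonempty S] (hirr : Irreducible q)
    (hq : ∀ s s', 0 ≤ q s s') (hsymm : ∀ s s', q s s' = q s' s) (p : S → ℝ) :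
    IsSteadyState q p ↔ p = fun _ => 1 / (Nat.card S : ℝ) := by
  have := Fintype.ofFinite S
  have hcard : (0 : ℝ) < Fintype.card S := by exact_mod_cast Fintype.card_pos
  constructor
  · rintro ⟨-, hsum, hbal⟩
    funext s
    rw [Nat.card_eq_fintype_card, one_div]
    exact hirr.eq_inv_card hq hsymm (fun s' => (hasSum_fintype _).unique (hbal s'))
      ((hasSum_fintype _).unique hsum) s
  · rintro rfl
    rw [Nat.card_eq_fintype_card]
    refine ⟨fun _ => by positivity, ?_, fun s' => ?_⟩
    · convert! hasSum_fintype (fun _ : S => 1 / (Fintype.card S : ℝ))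
      rw [Finset.sum_const, Finset.card_univ, nsmul_eq_mul, mul_one_div_cancel hcard.ne']
    · convert! hasSum_fintype (fun s : S => 1 / (Fintype.card S : ℝ) * generator q s s')
      rw [← Finset.mul_sum]
      simp_rw [generator_comm hsymm _ s', sum_generator, mul_zero]

end Generator

/-! ### Chains with uniform marginals -/

section Law

theorem setOf_forall_fin_add_two {Ω : Type w} {X : ℝ≥0 → Ω → S} (n : ℕ) (t : Fin (n + 2) → ℝ≥0)
    (s : Fin (n + 2) → S) :
    {ω | ∀ i, X (t i) ω = s i} =
      {ω | ∀ i : Fin (n + 1), X (t i.castSucc) ω = s i.castSucc} ∩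
        {ω | X (t (Fin.last (n + 1))) ω = s (Fin.last (n + 1))} := by
  ext ω
  exact Fin.forall_fin_succ'

variable {Ω : Type w} [MeasurableSpace Ω] {μ : Measure Ω} {X : ℝ≥0 → Ω → S}
  {P : ℝ≥0 → S → S → ℝ}

/-- The finite-dimensional distributions of `X` are those of a Markov chain with uniform initial
distribution and transition function `P`. -/
def HasUniformMarkovLaw (μ : Measure Ω) (X : ℝ≥0 → Ω → S) (P : ℝ≥0 → S → S → ℝ) : Prop :=
  ∀ (n : ℕ) (t : Fin (n + 1) → ℝ≥0) (s : Fin (n + 1) → S), StrictMono t →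
    μ.real {ω | ∀ i, X (t i) ω = s i} =
      (Nat.card S : ℝ)⁻¹ *
        ∏ i : Fin n, P (t i.succ - t i.castSucc) (s i.castSucc) (s i.succ)

namespace HasUniformMarkovLaw

theorem isStationary [IsFiniteMeasure μ] (h : HasUniformMarkovLaw μ X P) : IsStationary μ X := by
  intro n t t' s ht
  obtain - | n := n
  · simp
  · rw [← measureReal_eq_measureReal_iff, h n t s ht,
      h n (fun i => t i + t') s fun i j hij => add_lt_add_left (ht hij) t']
    simp only [add_tsub_add_eq_tsub_right]

/-- Reversal keeps the time increments, permutes the factors and exchanges the two states in each;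
the uniform initial weight does not depend on the state. -/
theorem isReversible [IsFiniteMeasure μ] (h : HasUniformMarkovLaw μ X P)
    (hP : ∀ u, 0 < u → ∀ s s', P u s s' = P u s' s) : IsReversible μ X := by
  intro n t t' s ht htt'
  obtain - | n := n
  · simp
  · have hset : {ω | ∀ i, X (t' - t i) ω = s i} =
        {ω | ∀ i, X (t' - t (Fin.rev i)) ω = s (Fin.rev i)} := by
      ext ω
      exact (Fin.revPerm.forall_congr_right (q := fun i => X (t' - t i) ω = s i)).symm
    rw [hset, ← measureReal_eq_measureReal_iff, h n t s ht,
      h n (fun i => t' - t (Fin.rev i)) (fun i => s (Fin.rev i)) fun i j hij =>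
        tsub_lt_tsub_left_of_le (htt' _) (ht (Fin.rev_lt_rev.2 hij)),
      ← Equiv.prod_comp Fin.revPerm]
    congr 1
    refine Finset.prod_congr rfl fun i _ => ?_
    simp only [Fin.revPerm_apply, Fin.rev_castSucc, Fin.rev_succ]
    rw [tsub_tsub_tsub_cancel_left (htt' _)]
    refine hP _ (tsub_pos_of_lt (ht ?_)) _ _
    exact Fin.castSucc_lt_succ

theorem real_one (h : HasUniformMarkovLaw μ X P) (t : ℝ≥0) (s : S) :
    μ.real {ω | X t ω = s} = (Nat.card S : ℝ)⁻¹ := by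
  simpa using h 0 (fun _ => t) (fun _ => s) (Subsingleton.strictMono (α := Fin 1) _)

theorem real_two (h : HasUniformMarkovLaw μ X P) {t u : ℝ≥0} (htu : t < u) (s s' : S) :
    μ.real ({ω | X t ω = s} ∩ {ω | X u ω = s'}) = (Nat.card S : ℝ)⁻¹ * P (u - t) s s' := by
  have := h 1 ![t, u] ![s, s'] (by simpa [Fin.strictMono_iff_lt_succ] using htu)
  simpa [Fin.forall_fin_two, Set.ofPred_and] using this

end HasUniformMarkovLaw

theorem cond_real_mul [IsFiniteMeasure μ] {A : Set Ω} (hA : MeasurableSet A) (B : Set Ω) :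
    (ProbabilityTheory.cond μ A).real B * μ.real A = μ.real (A ∩ B) := by
  simp only [measureReal_def, ← ENNReal.toReal_mul, ProbabilityTheory.cond_mul_eq_inter hA]

theorem measurableSet_forall_eq (hX : ∀ t s, MeasurableSet {ω | X t ω = s}) {n : ℕ}
    (t : Fin n → ℝ≥0) (s : Fin n → S) : MeasurableSet {ω | ∀ i, X (t i) ω = s i} := by
  rw [Set.ofPred_forall]
  exact MeasurableSet.iInter fun i => hX _ _

namespace HasUniformMarkovLaw

theorem ne_zero [Finite S] [Nonempty S] : (Nat.card S : ℝ)⁻¹ ≠ 0 :=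
  inv_ne_zero (Nat.cast_ne_zero.2 Nat.card_pos.ne')

theorem cond_real [Finite S] [Nonempty S] [IsFiniteMeasure μ] (h : HasUniformMarkovLaw μ X P)
    (hX : ∀ t s, MeasurableSet {ω | X t ω = s}) {t u : ℝ≥0} (htu : t < u) (s s' : S) :
    (ProbabilityTheory.cond μ {ω | X t ω = s}).real {ω | X u ω = s'} = P (u - t) s s' := by
  have := cond_real_mul (μ := μ) (hX t s) {ω | X u ω = s'}
  rw [h.real_two htu, h.real_one, mul_comm] at this
  exact mul_left_cancel₀ ne_zero this

open Classical in
theorem transProb_eq [Finite S] [Nonempty S] [IsProbabilityMeasure μ]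
    (h : HasUniformMarkovLaw μ X P) (hX : ∀ t s, MeasurableSet {ω | X t ω = s})
    (hzero : ∀ s s', P 0 s s' = if s = s' then 1 else 0) (t u : ℝ≥0) (s s' : S) :
    transProb μ X t u s s' = P u s s' := by
  -- The law concerns strictly increasing times only and says nothing about `P 0`, so this case
  -- rests on `hzero`.
  rcases eq_or_ne u 0 with rfl | hu
  · have := cond_real_mul (μ := μ) (hX t s) {ω | X (t + 0) ω = s'}
    rw [transProb, hzero]
    refine mul_right_cancel₀ (ne_zero (S := S)) ?_
    rw [← h.real_one t s, this, add_zero]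
    split_ifs with hs
    · rw [hs, Set.inter_self, one_mul]
    · rw [zero_mul, show {ω | X t ω = s} ∩ {ω | X t ω = s'} = ∅ from ?_, measureReal_empty]
      ext ω
      simp only [Set.mem_inter_iff, Set.mem_ofPred_eq, Set.mem_empty_iff_false, iff_false]
      rintro ⟨h1, h2⟩
      exact hs (h1.symm.trans h2)
  · rw [transProb, h.cond_real hX (lt_add_of_pos_right t (pos_iff_ne_zero.2 hu)),
      add_tsub_cancel_left]

open Classical in
theorem isCTMC [Finite S] [Nonempty S] {q : S → S → ℝ} [IsProbabilityMeasure μ]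
    (h : HasUniformMarkovLaw μ X P) (hX : ∀ t s, MeasurableSet {ω | X t ω = s})
    (hzero : ∀ s s', P 0 s s' = if s = s' then 1 else 0)
    (hderiv : ∀ s s', Tendsto (fun u : ℝ≥0 => (P u s s' - if s = s' then 1 else 0) / (u : ℝ))
      (𝓝[>] 0) (𝓝 (generator q s s'))) : IsCTMC μ X q where
  prob := inferInstance
  measurableSet_eq := hX
  markov n t s ht hne := by
    have hlt : t (Fin.last n).castSucc < t (Fin.last (n + 1)) := ht (Fin.castSucc_lt_last _)
    rw [h.cond_real hX hlt]
    -- Multiplied by the probability of the past, the claim says that the joint law is that of the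
    -- past times the last factor.
    refine mul_right_cancel₀ (measureReal_ne_zero_iff (by finiteness) |>.2 hne) ?_
    rw [cond_real_mul (measurableSet_forall_eq hX _ _), ← setOf_forall_fin_add_two, h _ _ _ ht,
      h n (fun i => t i.castSucc) (fun i => s i.castSucc) (ht.comp Fin.strictMono_castSucc),
      Fin.prod_univ_castSucc]
    simp only [Fin.succ_castSucc, Fin.succ_last]
    ring
  homogeneous t t' u s s' _ _ := by
    rw [h.transProb_eq hX hzero, h.transProb_eq hX hzero]
  rates t s s' _ := by
    simpa only [h.transProb_eq hX hzero] using hderiv s s'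

end HasUniformMarkovLaw

end Law

/-! ### Symmetry of doubly stochastic semigroups -/

open scoped Matrix.Norms.Operator in
theorem norm_le_one_of_stochastic [Fintype S] {A : Matrix S S ℝ} (hA : ∀ s s', 0 ≤ A s s')
    (hsum : ∀ s, ∑ s', A s s' = 1) : ‖A‖ ≤ 1 := by
  rw [Matrix.linfty_opNorm_def]
  norm_cast
  refine Finset.sup_le fun s _ => ?_
  rw [← NNReal.coe_le_coe]
  push_cast
  simp only [Real.norm_of_nonneg (hA _ _), hsum, le_refl]

/-- Telescoping between two contractions: the error grows only linearly in `n`, which is what a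
first-order estimate at zero can absorb. -/
theorem norm_pow_sub_pow_le {A : Type*} [NormedRing A] [NormOneClass A] {a b : A} (ha : ‖a‖ ≤ 1)
    (hb : ‖b‖ ≤ 1) (n : ℕ) : ‖a ^ n - b ^ n‖ ≤ n * ‖a - b‖ := by
  induction n with
  | zero => simp
  | succ n ih =>
    have : a ^ (n + 1) - b ^ (n + 1) = a ^ n * (a - b) + (a ^ n - b ^ n) * b := by
      rw [pow_succ, pow_succ]; noncomm_ring
    rw [this]
    calc _ ≤ ‖a ^ n‖ * ‖a - b‖ + ‖a ^ n - b ^ n‖ * ‖b‖ :=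
          (norm_add_le _ _).trans (add_le_add (norm_mul_le _ _) (norm_mul_le _ _))
      _ ≤ 1 * ‖a - b‖ + (n * ‖a - b‖) * 1 := by
          gcongr
          exact (norm_pow_le a n).trans (pow_le_one₀ (norm_nonneg _) ha)
      _ = _ := by push_cast; ring

open scoped Matrix.Norms.Operator in
/-- A doubly stochastic semigroup whose derivative at zero is symmetric is symmetric. -/
theorem isSymm_of_tendsto [Fintype S] [DecidableEq S] [Nonempty S] {P : ℝ≥0 → Matrix S S ℝ}
    {Q : Matrix S S ℝ} (hnonneg : ∀ u s s', 0 ≤ P u s s') (hrow : ∀ u s, ∑ s', P u s s' = 1)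
    (hcol : ∀ u s', ∑ s, P u s s' = 1) (hadd : ∀ u v, 0 < u → 0 < v → P (u + v) = P u * P v)
    (hQ : Q.IsSymm)
    (hderiv : ∀ s s', Tendsto (fun h : ℝ≥0 => (P h s s' - if s = s' then 1 else 0) / (h : ℝ))
      (𝓝[>] 0) (𝓝 (Q s s')))
    (u : ℝ≥0) (hu : 0 < u) : (P u).IsSymm := by
  have hpow : ∀ h, 0 < h → ∀ n : ℕ, P ((n + 1) • h) = P h ^ (n + 1) := by
    intro h hh n
    induction n with
    | zero => simp
    | succ n ih => rw [succ_nsmul, hadd _ _ (by positivity) hh, ih, pow_succ _ (n + 1)]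
  -- Difference quotient of `P - Pᵀ`: the identity matrix cancels, and the limit is `Q - Qᵀ = 0`.
  set d : ℝ≥0 → Matrix S S ℝ := fun h => (h : ℝ)⁻¹ • (P h - (P h).transpose) with hd
  have hlim : Tendsto d (𝓝[>] 0) (𝓝 0) := by
    refine tendsto_pi_nhds.2 fun s => tendsto_pi_nhds.2 fun s' => ?_
    have := (hderiv s s').sub (hderiv s' s)
    rw [hQ.apply s' s, sub_self] at this
    refine this.congr fun h => ?_
    simp only [hd, Matrix.smul_apply, Matrix.sub_apply, Matrix.transpose_apply, smul_eq_mul,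
      eq_comm (a := s') (b := s)]
    ring
  have hseq : Tendsto (fun n : ℕ => u / ((n : ℝ≥0) + 1)) atTop (𝓝[>] 0) := by
    refine tendsto_nhdsWithin_iff.2 ⟨?_, Eventually.of_forall fun n => ?_⟩
    · rw [← NNReal.tendsto_coe]
      push_cast
      exact tendsto_const_div_atTop_nhds_zero_nat (u : ℝ) |>.comp (tendsto_add_atTop_nat 1)
        |>.congr fun n => by simp
    · exact div_pos hu (by positivity)
  -- With `h = u / (n + 1)`, both `P u` and its transpose are `(n + 1)`-st powers of contractions,
  -- and the factor `n + 1` is `u / h`.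
  have hbound : ∀ n : ℕ, ‖P u - (P u).transpose‖ ≤ u * ‖d (u / ((n : ℝ≥0) + 1))‖ := by
    intro n
    set h := u / ((n : ℝ≥0) + 1) with hh
    have hpos : 0 < h := div_pos hu (by positivity)
    have hmul : u = (n + 1) • h := by
      rw [nsmul_eq_mul, hh]
      push_cast
      field_simp
    have h1 : ‖P h‖ ≤ 1 := norm_le_one_of_stochastic (hnonneg h) (hrow h)
    have h2 : ‖(P h).transpose‖ ≤ 1 :=
      norm_le_one_of_stochastic (fun s s' => hnonneg h s' s) (hcol h)
    have h3 : P u = P h ^ (n + 1) := by rw [← hpow h hpos, ← hmul]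
    have h4 : (P u).transpose = (P h).transpose ^ (n + 1) := by rw [h3, Matrix.transpose_pow]
    rw [h4, h3]
    refine (norm_pow_sub_pow_le h1 h2 _).trans_eq ?_
    have hu' : (u : ℝ) = ((n + 1 : ℕ) : ℝ) * h := by
      conv_lhs => rw [hmul]
      simp
    have hpos' : (h : ℝ) ≠ 0 := by exact_mod_cast hpos.ne'
    rw [hd, hu']
    simp only [norm_smul, norm_inv, NNReal.norm_eq]
    field_simp
  have hlim' : Tendsto (fun n : ℕ => (u : ℝ) * ‖d (u / ((n : ℝ≥0) + 1))‖) atTop (𝓝 0) := by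
    simpa using ((hlim.comp hseq).norm).const_mul (u : ℝ)
  have := ge_of_tendsto' hlim' hbound
  exact (sub_eq_zero.1 (norm_le_zero_iff.1 this)).symm

/-! ### The law of a stationary chain -/

section Uniqueness

variable {Ω : Type w} [MeasurableSpace Ω] {μ : Measure Ω} {X : ℝ≥0 → Ω → S} {q : S → S → ℝ}

theorem IsStationary.measureReal_eq (h : IsStationary μ X) (t : ℝ≥0) (s : S) :
    μ.real {ω | X t ω = s} = μ.real {ω | X 0 ω = s} := by
  have := h 1 (fun _ => 0) t (fun _ => s) (Subsingleton.strictMono _)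
  simp only [zero_add, forall_const] at this
  rw [measureReal_def, measureReal_def, this]

/-- Total probability. Restricting `μ` to `A` avoids any measurability assumption on `A`. -/
theorem IsCTMC.sum_measureReal_inter [Fintype S] (h : IsCTMC μ X q) (t : ℝ≥0) {A : Set Ω} :
    ∑ s, μ.real (A ∩ {ω | X t ω = s}) = μ.real A := by
  have := h.prob
  have hA := measureReal_biUnion_finset (μ := μ.restrict A) (s := Finset.univ)
    (f := fun s => {ω | X t ω = s})
    (fun s _ s' _ hss' => Set.disjoint_left.2 fun ω (h1 : _ = _) (h2 : _ = _) =>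
      hss' (h1.symm.trans h2)) (fun s _ => h.measurableSet_eq t s)
  have huniv : (⋃ s ∈ (Finset.univ : Finset S), {ω | X t ω = s}) = Set.univ := by
    ext ω; simp
  rw [huniv, measureReal_restrict_apply_univ] at hA
  rw [hA]
  refine Finset.sum_congr rfl fun s _ => ?_
  rw [measureReal_restrict_apply (h.measurableSet_eq t s), Set.inter_comm]

/-- The law of a stationary finite chain with symmetric irreducible rates. -/
theorem IsCTMC.measureReal_eq_inv_card [Fintype S] [Nonempty S] (h : IsCTMC μ X q)
    (hst : IsStationary μ X) (hirr : Irreducible q) (hq : ∀ s s', 0 ≤ q s s')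
    (hsymm : ∀ s s', q s s' = q s' s) (t : ℝ≥0) (s : S) :
    μ.real {ω | X t ω = s} = (Fintype.card S : ℝ)⁻¹ := by
  classical
  have := h.prob
  rw [hst.measureReal_eq]
  revert s
  refine hirr.eq_inv_card hq hsymm (p := fun s => μ.real {ω | X 0 ω = s}) (fun s' => ?_) ?_
  · set p : S → ℝ := fun s => μ.real {ω | X 0 ω = s}
    -- By stationarity these sums vanish for every `u`; their limit is the left side of the balance
    -- equation.
    have hlim : Tendsto (fun u : ℝ≥0 => ∑ s, p s *
        ((transProb μ X 0 u s s' - if s = s' then 1 else 0) / (u : ℝ))) (𝓝[>] 0)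
        (𝓝 (∑ s, p s * generator q s s')) := by
      refine tendsto_finsetSum _ fun s _ => ?_
      -- `rates` is silent about null states, but these carry weight zero.
      by_cases hs : μ {ω | X 0 ω = s} = 0
      · have : p s = 0 := by simp [p, measureReal_def, hs]
        simp [this]
      · refine Tendsto.const_mul _ ?_
        convert! h.rates 0 s s' hs
    refine tendsto_nhds_unique hlim (tendsto_const_nhds.congr fun u => ?_)
    have hterm : ∀ s, p s * transProb μ X 0 u s s' =
        μ.real ({ω | X u ω = s'} ∩ {ω | X 0 ω = s}) := fun s => by
      rw [mul_comm, transProb, zero_add, cond_real_mul (h.measurableSet_eq 0 s), Set.inter_comm]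
    simp_rw [mul_div_assoc', mul_sub, ← Finset.sum_div, Finset.sum_sub_distrib, hterm,
      h.sum_measureReal_inter, hst.measureReal_eq u]
    simp [p]
  · simpa using h.sum_measureReal_inter 0 (A := Set.univ)

/-- Each new time contributes a conditional probability, reduced to the current state by the Markov
property and to time zero by homogeneity. The latter always applies, since uniform marginals leave
no null state. -/
theorem IsCTMC.hasUniformMarkovLaw [Fintype S] [Nonempty S] (h : IsCTMC μ X q)
    (hst : IsStationary μ X) (hirr : Irreducible q) (hq : ∀ s s', 0 ≤ q s s')
    (hsymm : ∀ s s', q s s' = q s' s) : HasUniformMarkovLaw μ X (transProb μ X 0) := by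
  have := h.prob
  have hpi := h.measureReal_eq_inv_card hst hirr hq hsymm
  have hne : ∀ t s, μ {ω | X t ω = s} ≠ 0 := fun t s h0 => by
    have := hpi t s
    rw [measureReal_def, h0, ENNReal.toReal_zero] at this
    have : (Fintype.card S : ℝ)⁻¹ ≠ 0 := by simp
    exact this (by assumption : _ = _).symm
  intro n
  induction n with
  | zero =>
    intro t s _
    simpa [Fin.forall_fin_one] using hpi (t 0) (s 0)
  | succ n ih =>
    intro t s ht
    have hprev := ih (fun i => t i.castSucc) (fun i => s i.castSucc)
      (ht.comp Fin.strictMono_castSucc)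
    rw [setOf_forall_fin_add_two, ← cond_real_mul (measurableSet_forall_eq h.measurableSet_eq _ _),
      Fin.prod_univ_castSucc]
    -- After a null past the Markov property is unavailable, but by induction the shorter product is
    -- already zero.
    by_cases h0 : μ {ω | ∀ i : Fin (n + 1), X (t i.castSucc) ω = s i.castSucc} = 0
    · have hr : μ.real {ω | ∀ i : Fin (n + 1), X (t i.castSucc) ω = s i.castSucc} = 0 := by
        rw [measureReal_def, h0, ENNReal.toReal_zero]
      rw [hr] at hprev ⊢
      simp only [Fin.succ_castSucc]
      rw [← mul_assoc, ← hprev, mul_zero, zero_mul]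
    · have hlt : t (Fin.last n).castSucc < t (Fin.last (n + 1)) := ht (Fin.castSucc_lt_last _)
      rw [h.markov n t s ht h0, hprev, Fin.succ_last]
      have := h.homogeneous (t (Fin.last n).castSucc) 0
        (t (Fin.last (n + 1)) - t (Fin.last n).castSucc) (s (Fin.last n).castSucc)
        (s (Fin.last (n + 1))) (hne _ _) (hne _ _)
      rw [transProb, add_tsub_cancel_of_le hlt.le] at this
      rw [this]
      simp only [Fin.succ_castSucc]
      ring

theorem IsCTMC.isReversible [Finite S] [Nonempty S] (h : IsCTMC μ X q)
    (hst : IsStationary μ X) (hirr : Irreducible q) (hq : ∀ s s', 0 ≤ q s s')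
    (hsymm : ∀ s s', q s s' = q s' s) : IsReversible μ X := by
  classical
  have := Fintype.ofFinite S
  have := h.prob
  have hpi := h.measureReal_eq_inv_card hst hirr hq hsymm
  have hlaw := h.hasUniformMarkovLaw hst hirr hq hsymm
  have hcard : (Nat.card S : ℝ)⁻¹ ≠ 0 := HasUniformMarkovLaw.ne_zero
  have hne : ∀ t s, μ {ω | X t ω = s} ≠ 0 := fun t s h0 => by
    have := hlaw.real_one t s
    rw [measureReal_def, h0, ENNReal.toReal_zero] at this
    exact hcard this.symm
  -- Weighted by the uniform law, transition probabilities become joint probabilities. Row sums,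
  -- column sums and the semigroup law then all follow from total probability.
  have hterm : ∀ u s s', (Nat.card S : ℝ)⁻¹ * transProb μ X 0 u s s' =
      μ.real ({ω | X 0 ω = s} ∩ {ω | X u ω = s'}) := fun u s s' => by
    rw [mul_comm, ← hlaw.real_one 0 s, transProb, zero_add, cond_real_mul (h.measurableSet_eq 0 s)]
  refine hlaw.isReversible fun u hu s s' => ?_
  refine (isSymm_of_tendsto (P := fun u => Matrix.of (transProb μ X 0 u))
    (Q := Matrix.of (generator q)) (fun _ _ _ => measureReal_nonneg) (fun u s => ?_)
    (fun u s' => ?_) (fun u v hu hv => ?_) ?_ (fun s s' => ?_) u hu).apply s' s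
  · refine mul_left_cancel₀ hcard ?_
    simp_rw [Finset.mul_sum, Matrix.of_apply, hterm, h.sum_measureReal_inter, hlaw.real_one,
      mul_one]
  · refine mul_left_cancel₀ hcard ?_
    simp_rw [Finset.mul_sum, Matrix.of_apply, hterm, Set.inter_comm _ {ω | X u ω = s'},
      h.sum_measureReal_inter, hlaw.real_one, mul_one]
  · ext s s'
    refine mul_left_cancel₀ hcard ?_
    simp only [Matrix.mul_apply, Matrix.of_apply, hterm, Finset.mul_sum]
    rw [← h.sum_measureReal_inter u]
    refine Finset.sum_congr rfl fun x _ => ?_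
    -- Chapman-Kolmogorov: the law at three times, summed over the middle state.
    have := hlaw 2 ![0, u, u + v] ![s, x, s'] (by
      simp [Fin.strictMono_iff_lt_succ, Fin.forall_fin_two, hu, hv])
    simp only [Fin.prod_univ_two, Fin.forall_fin_succ] at this
    simp at this
    rw [Nat.card_eq_fintype_card, ← this]
    congr 1
    ext ω
    simp
    tauto
  · exact Matrix.IsSymm.ext fun s s' => generator_comm hsymm s' s
  · simpa only [Matrix.of_apply] using! h.rates 0 s s' (hne 0 s)

end Uniqueness

/-! ### Kolmogorov extension for finite state spaces -/

/-- Kolmogorov's extension theorem for families of random variables on a finite set. -/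
theorem exists_isProjectiveLimit {ι : Type u} {E : Type v} [Finite E] [MeasurableSpace E]
    {P : ∀ J : Finset ι, Measure (J → E)} [∀ J, IsFiniteMeasure (P J)]
    (hP : IsProjectiveMeasureFamily (α := fun _ => E) P) :
    ∃ μ : Measure (ι → E), IsProjectiveLimit (α := fun _ => E) μ P := by
  let : TopologicalSpace E := ⊥
  have : DiscreteTopology E := ⟨rfl⟩
  set m := projectiveFamilyContent hP
  have hsub : m.IsSigmaSubadditive := by
    refine isSigmaSubadditive_of_addContent_iUnion_eq_tsum isSetRing_measurableCylinders
      fun f hf hfU hdisj => ?_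
    refine addContent_iUnion_eq_sum_of_tendsto_zero isSetRing_measurableCylinders m
      (fun s _ => projectiveFamilyContent_ne_top hP) (fun s hs hanti hinter => ?_) hf hfU hdisj
    -- For finite discrete `E` the product is compact and cylinders are closed. Decreasing cylinders
    -- with empty intersection are therefore eventually empty, which gives continuity of the content
    -- at `∅`.
    have hclosed : ∀ n, IsClosed (s n) := fun n => by
      obtain ⟨J, T, -, hT⟩ := (mem_measurableCylinders _).1 (hs n)
      rw [hT]
      exact IsClosed.cylinder J (isClosed_discrete T)
    obtain ⟨n, hn⟩ : ∃ n, s n = ∅ := by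
      by_contra! h
      have := IsCompact.nonempty_iInter_of_sequence_nonempty_isCompact_isClosed s
        (fun i => hanti (Nat.le_succ i)) h (hclosed 0).isCompact hclosed
      exact this.ne_empty hinter
    refine tendsto_const_nhds.congr' ?_
    filter_upwards [eventually_ge_atTop n] with k hk
    rw [Set.subset_eq_empty (hanti hk) hn, addContent_empty]
  refine ⟨m.measure isSetSemiring_measurableCylinders generateFrom_measurableCylinders.ge hsub,
    fun J => ?_⟩
  ext A hA
  rw [Measure.map_apply (Finset.measurable_restrict J) hA]
  exact (AddContent.measure_eq _ _ generateFrom_measurableCylinders.symm _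
    (cylinder_mem_measurableCylinders J A hA)).trans (projectiveFamilyContent_cylinder hP hA)

/-! ### Path measures of a Markov semigroup -/

/-- Transition functions of Markov chains with a finite state space. -/
structure IsMarkovSemigroup {E : Type u} [Fintype E] (P : ℝ≥0 → Matrix E E ℝ) : Prop where
  nonneg : ∀ u s s', 0 ≤ P u s s'
  sum_row : ∀ u s, ∑ s', P u s s' = 1
  add : ∀ u v, P (u + v) = P u * P v

open Classical in
theorem measurable_update_const {E : Type u} [MeasurableSpace E] (u : ℝ≥0) (a : E) :
    Measurable fun x : ℝ≥0 → E => Function.update x u a := by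
  refine measurable_pi_lambda _ fun i => ?_
  rcases eq_or_ne i u with rfl | h
  · simp
  · simpa [h] using measurable_pi_apply i

section PathMeasure

variable {E : Type u} [Fintype E] {P : ℝ≥0 → Matrix E E ℝ}

theorem IsMarkovSemigroup.sum_ofReal (hP : IsMarkovSemigroup P) (u : ℝ≥0) (s : E) :
    ∑ a, ENNReal.ofReal (P u s a) = 1 := by
  rw [← ENNReal.ofReal_sum_of_nonneg fun a _ => hP.nonneg u s a, hP.sum_row, ENNReal.ofReal_one]

variable [Nonempty E] [MeasurableSpace E]

open Classical in
/-- The law of the values at the times in a sorted list of a Markov chain that is in state `s` at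
time `t`; all other values are arbitrary. -/
noncomputable def pathMeasure (P : ℝ≥0 → Matrix E E ℝ) :
    ℝ≥0 → E → List ℝ≥0 → Measure (ℝ≥0 → E)
  | _, _, [] => Measure.dirac fun _ => Classical.arbitrary E
  | t, s, u :: l => ∑ a, ENNReal.ofReal (P (u - t) s a) •
      (pathMeasure P u a l).map fun x => Function.update x u a

open Classical in
theorem pathMeasure_cons_apply (t : ℝ≥0) (s : E) (u : ℝ≥0) (l : List ℝ≥0) {A : Set (ℝ≥0 → E)}
    (hA : MeasurableSet A) :
    pathMeasure P t s (u :: l) A = ∑ a, ENNReal.ofReal (P (u - t) s a) *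
      pathMeasure P u a l ((fun x => Function.update x u a) ⁻¹' A) := by
  simp [pathMeasure, Measure.map_apply (measurable_update_const u _) hA]

namespace IsMarkovSemigroup

theorem isProbabilityMeasure_pathMeasure (hP : IsMarkovSemigroup P) (t : ℝ≥0) (s : E)
    (l : List ℝ≥0) : IsProbabilityMeasure (pathMeasure P t s l) := by
  induction l generalizing t s with
  | nil => rw [pathMeasure]; infer_instance
  | cons u l ih =>
    constructor
    rw [pathMeasure_cons_apply _ _ _ _ MeasurableSet.univ]
    have : ∀ a, pathMeasure P u a l Set.univ = 1 := fun a => (ih u a).measure_univ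
    simp [this, hP.sum_ofReal]

/-- The Chapman-Kolmogorov equation for path measures. -/
theorem sum_mul_pathMeasure (hP : IsMarkovSemigroup P) {t u : ℝ≥0} (htu : t ≤ u) (s : E)
    {l : List ℝ≥0} (hl : ∀ v ∈ l, u ≤ v) {A : Set (ℝ≥0 → E)} (hA : MeasurableSet A) :
    ∑ a, ENNReal.ofReal (P (u - t) s a) * pathMeasure P u a l A = pathMeasure P t s l A := by
  cases l with
  | nil => simp only [pathMeasure, ← Finset.sum_mul, hP.sum_ofReal, one_mul]
  | cons v l =>
    have huv := hl v List.mem_cons_self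
    have hadd : v - t = (u - t) + (v - u) := by
      rw [add_comm, tsub_add_tsub_cancel huv htu]
    simp_rw [pathMeasure_cons_apply _ _ _ _ hA, Finset.mul_sum]
    rw [Finset.sum_comm]
    refine Finset.sum_congr rfl fun b _ => ?_
    rw [hadd, hP.add, Matrix.mul_apply, ENNReal.ofReal_sum_of_nonneg fun a _ =>
      mul_nonneg (hP.nonneg _ _ _) (hP.nonneg _ _ _), Finset.sum_mul]
    refine Finset.sum_congr rfl fun a _ => ?_
    rw [ENNReal.ofReal_mul (hP.nonneg _ _ _), mul_assoc]

/-- Times on which an event does not depend can be dropped. -/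
theorem pathMeasure_filter (hP : IsMarkovSemigroup P) (J : Finset ℝ≥0) {t : ℝ≥0} {s : E}
    {l : List ℝ≥0} (hl : (t :: l).Pairwise (· ≤ ·)) {A : Set (ℝ≥0 → E)} (hA : MeasurableSet A)
    (hAJ : ∀ x y, (∀ j ∈ J, x j = y j) → (x ∈ A ↔ y ∈ A)) :
    pathMeasure P t s (l.filter (· ∈ J)) A = pathMeasure P t s l A := by
  classical
  induction l generalizing t s A with
  | nil => rfl
  | cons u l ih =>
    obtain ⟨ht, hul⟩ := List.pairwise_cons.1 hl
    rw [pathMeasure_cons_apply _ _ _ _ hA]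
    by_cases hu : u ∈ J
    · rw [List.filter_cons_of_pos (by simpa using hu), pathMeasure_cons_apply _ _ _ _ hA]
      refine Finset.sum_congr rfl fun a _ => ?_
      rw [ih hul (measurable_update_const u a hA)]
      intro x y hxy
      refine hAJ _ _ fun j hj => ?_
      simp only [Function.update_apply]
      split_ifs
      · rfl
      · exact hxy j hj
    -- `A` ignores the value at `u`, so the update there has no effect and summing over that value
    -- is Chapman-Kolmogorov.
    · rw [List.filter_cons_of_neg (by simpa using hu),
        ← hP.sum_mul_pathMeasure (ht u List.mem_cons_self) s
          (fun v hv => (List.pairwise_cons.1 hul).1 v (List.mem_of_mem_filter hv)) hA]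
      refine Finset.sum_congr rfl fun a _ => ?_
      rw [ih hul hA hAJ]
      congr 2
      ext x
      refine hAJ _ _ fun j hj => ?_
      exact (Function.update_of_ne (fun h : j = u => hu (h ▸ hj)) _ _).symm

/-- At each time only the prescribed value contributes to the sum. The times must be distinct,
because the update at an earlier list entry overrides later ones; `t 0` is only a starting time and
may coincide with `t 1`. -/
theorem pathMeasure_ofFn [MeasurableSingletonClass E] (hP : IsMarkovSemigroup P) {n : ℕ}
    (t : Fin (n + 1) → ℝ≥0) (ht : Function.Injective fun i : Fin n => t i.succ)
    (s : Fin (n + 1) → E) :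
    pathMeasure P (t 0) (s 0) (List.ofFn fun i : Fin n => t i.succ)
        {x | ∀ i : Fin n, x (t i.succ) = s i.succ} =
      ENNReal.ofReal (∏ i : Fin n, P (t i.succ - t i.castSucc) (s i.castSucc) (s i.succ)) := by
  classical
  have hmeas : ∀ (n : ℕ) (t : Fin n → ℝ≥0) (s : Fin n → E),
      MeasurableSet {x : ℝ≥0 → E | ∀ i, x (t i) = s i} := fun n t s =>
    measurableSet_forall_eq (X := fun u (x : ℝ≥0 → E) => x u)
      (fun u a => (measurableSet_singleton a).preimage (measurable_pi_apply u)) t s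
  induction n with
  | zero => simp [pathMeasure]
  | succ n ih =>
    rw [List.ofFn_succ, pathMeasure_cons_apply _ _ _ _ (hmeas _ _ _), Fin.prod_univ_succ,
      ENNReal.ofReal_mul (hP.nonneg _ _ _)]
    have := ih (fun i => t i.succ) (fun i j h => Fin.succ_injective _ (ht h)) fun i => s i.succ
    rw [Finset.sum_eq_single (s (Fin.succ 0))]
    · simp only [Fin.castSucc_zero, Fin.castSucc_succ] at this ⊢
      rw [← this]
      congr 2
      ext x
      simp only [Set.mem_preimage, Set.mem_ofPred_eq]
      rw [Fin.forall_fin_succ]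
      simp only [Function.update_self, true_and]
      refine forall_congr' fun i => ?_
      rw [Function.update_of_ne (fun h => Fin.succ_ne_zero i (ht h))]
    · intro a _ ha
      rw [Set.eq_empty_iff_forall_notMem (s := _ ⁻¹' _) |>.2, measure_empty, mul_zero]
      intro x hx
      exact ha (by simpa using hx 0)
    · simp

/-- A Markov chain with uniform initial distribution and a given doubly stochastic transition
function exists. -/
theorem exists_hasUniformMarkovLaw [MeasurableSingletonClass E] (hP : IsMarkovSemigroup P)
    (hcol : ∀ u s', ∑ s, P u s s' = 1) :
    ∃ μ : Measure (ℝ≥0 → E), IsProbabilityMeasure μ ∧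
      HasUniformMarkovLaw μ (fun u x => x u) fun u s s' => P u s s' := by
  classical
  set N : List ℝ≥0 → Measure (ℝ≥0 → E) := fun l =>
    ∑ s, ENNReal.ofReal (Nat.card E : ℝ)⁻¹ • pathMeasure P 0 s l
  have hcard : (Fintype.card E : ℝ) ≠ 0 := by simp
  have hN : ∀ l A, N l A = ∑ s, ENNReal.ofReal (Nat.card E : ℝ)⁻¹ * pathMeasure P 0 s l A :=
    fun l A => by simp [N]
  have hNprob : ∀ l, IsProbabilityMeasure (N l) := fun l => ⟨by
    rw [hN]
    have : ∀ s, pathMeasure P 0 s l Set.univ = 1 :=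
      fun s => (hP.isProbabilityMeasure_pathMeasure 0 s l).measure_univ
    simp only [this, mul_one]
    rw [← ENNReal.ofReal_sum_of_nonneg fun _ _ => by positivity]
    simp [hcard]⟩
  set F : ∀ J : Finset ℝ≥0, Measure (J → E) := fun J => (N J.sort).map J.restrict with hF
  have hFprob : ∀ J, IsProbabilityMeasure (F J) := fun J =>
    Measure.isProbabilityMeasure_map (Finset.measurable_restrict J).aemeasurable
  have hproj : IsProjectiveMeasureFamily (α := fun _ => E) F := by
    intro I J hJI
    ext A hA
    rw [hF, Measure.map_map (Finset.measurable_restrict₂ hJI) (Finset.measurable_restrict I),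
      Finset.restrict₂_comp_restrict, Measure.map_apply (Finset.measurable_restrict J) hA,
      Measure.map_apply (Finset.measurable_restrict J) hA, hN, hN]
    -- Projectivity amounts to dropping from the sorted list of `I` the times outside `J`.
    have hsort : I.sort.filter (· ∈ J) = J.sort := by
      have h1 : (I.sort.filter (· ∈ J)).Pairwise (· ≤ ·) :=
        (Finset.pairwise_sort I _).filter _
      have h2 : (I.sort.filter (· ∈ J)).Nodup := (Finset.sort_nodup I _).filter _
      rw [← (List.toFinset_sort _ h2).2 h1]
      congr 1
      ext x
      simp only [List.mem_toFinset, List.mem_filter, Finset.mem_sort, decide_eq_true_eq]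
      exact ⟨fun h => h.2, fun h => ⟨hJI h, h⟩⟩
    refine Finset.sum_congr rfl fun s _ => ?_
    rw [← hsort, hP.pathMeasure_filter J _ (Finset.measurable_restrict J hA)]
    · intro x y hxy
      have : J.restrict x = J.restrict y := funext fun j => hxy j j.2
      rw [Set.mem_preimage, Set.mem_preimage, this]
    · exact List.pairwise_cons.2 ⟨fun _ _ => zero_le, Finset.pairwise_sort I _⟩
  obtain ⟨μ, hμ⟩ := exists_isProjectiveLimit hproj
  have hμprob : IsProbabilityMeasure μ := hμ.isProbabilityMeasure
  refine ⟨μ, hμprob, fun n t s ht => ?_⟩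
  set J : Finset ℝ≥0 := (List.ofFn t).toFinset with hJ
  have hsort : J.sort = List.ofFn t :=
    (List.toFinset_sort _ (List.nodup_ofFn.2 ht.injective)).2
      (List.sortedLE_ofFn_iff.2 ht.monotone).pairwise
  have hmem : ∀ i, t i ∈ J := fun i =>
    List.mem_toFinset.2 (List.mem_ofFn.2 ⟨i, rfl⟩)
  have hset : {x : ℝ≥0 → E | ∀ i, x (t i) = s i} =
      J.restrict ⁻¹' {y | ∀ i, y ⟨t i, hmem i⟩ = s i} := rfl
  have hmeas : MeasurableSet {y : J → E | ∀ i, y ⟨t i, hmem i⟩ = s i} := by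
    rw [Set.ofPred_forall]
    exact MeasurableSet.iInter fun i => 
      (measurableSet_singleton (s i)).preimage (measurable_pi_apply (⟨t i, hmem i⟩ : J))
  have hμN : μ {x | ∀ i, x (t i) = s i} = N (List.ofFn t) {x | ∀ i, x (t i) = s i} := by
    rw [hset, ← Measure.map_apply (Finset.measurable_restrict J) hmeas, hμ J, hF,
      Measure.map_apply (Finset.measurable_restrict J) hmeas, hsort]
  -- The chain starts in `a` at time `0`, prepended to `t`. Summing over `a`, the column sums remove
  -- the factor `P (t 0) a (s 0)`.
  have hterm : ∀ a, pathMeasure P 0 a (List.ofFn t) {x | ∀ i, x (t i) = s i} =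
      ENNReal.ofReal (P (t 0) a (s 0) *
        ∏ i : Fin n, P (t i.succ - t i.castSucc) (s i.castSucc) (s i.succ)) := fun a => by
    have := hP.pathMeasure_ofFn (Fin.cons 0 t : Fin (n + 2) → ℝ≥0)
      (by simpa using ht.injective) (Fin.cons a s : Fin (n + 2) → E)
    simpa [Fin.prod_univ_succ (n := n)] using this
  have hnn : ∀ a, 0 ≤ P (t 0) a (s 0) *
      ∏ i : Fin n, P (t i.succ - t i.castSucc) (s i.castSucc) (s i.succ) := fun a =>
    mul_nonneg (hP.nonneg _ _ _) (Finset.prod_nonneg fun _ _ => hP.nonneg _ _ _)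
  rw [measureReal_def, hμN, hN]
  simp_rw [hterm]
  rw [← Finset.mul_sum, ← ENNReal.ofReal_sum_of_nonneg fun a _ => hnn a, ← Finset.sum_mul, hcol,
    one_mul, ENNReal.toReal_mul, ENNReal.toReal_ofReal (by positivity),
    ENNReal.toReal_ofReal (Finset.prod_nonneg fun _ _ => hP.nonneg _ _ _)]

end IsMarkovSemigroup

end PathMeasure

/-! ### The semigroup generated by a matrix -/

section Exp

variable {E : Type u} [Fintype E] [DecidableEq E]

open scoped Matrix.Norms.Operator in
theorem hasSum_exp_apply (A : Matrix E E ℝ) (s s' : E) :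
    HasSum (fun n : ℕ => ((n.factorial : ℝ)⁻¹ • A ^ n) s s') (NormedSpace.exp A s s') :=
  Pi.hasSum.1 (Pi.hasSum.1 (NormedSpace.exp_series_hasSum_exp' (𝕂 := ℝ) A) s) s'

theorem exp_nonneg_of_nonneg {A : Matrix E E ℝ} (hA : ∀ s s', 0 ≤ A s s') (s s' : E) :
    0 ≤ NormedSpace.exp A s s' := by
  refine (hasSum_exp_apply A s s').nonneg fun n => ?_
  rw [Matrix.smul_apply, smul_eq_mul]
  refine mul_nonneg (by positivity) ?_
  induction n generalizing s s' with
  | zero => rw [pow_zero, Matrix.one_apply]; split_ifs <;> norm_num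
  | succ n ih =>
    rw [pow_succ, Matrix.mul_apply]
    exact Finset.sum_nonneg fun x _ => mul_nonneg (ih s x) (hA x s')

/-- Adding a large multiple `c` of the identity makes all entries nonnegative, and only multiplies
the exponential by `e ^ c`. -/
theorem exp_nonneg_of_offDiag_nonneg {A : Matrix E E ℝ} (hA : ∀ s s', s ≠ s' → 0 ≤ A s s')
    (s s' : E) : 0 ≤ NormedSpace.exp A s s' := by
  set c : ℝ := ∑ x, |A x x|
  have hc : ∀ x, 0 ≤ A x x + c := fun x => by
    have : |A x x| ≤ c :=
      Finset.single_le_sum (f := fun x => |A x x|) (fun _ _ => abs_nonneg _) (Finset.mem_univ x)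
    linarith [neg_abs_le (A x x)]
  have hsplit : A = (A + c • 1) + Matrix.diagonal fun _ => -c := by
    rw [← Matrix.smul_one_eq_diagonal]
    simp
  have hcomm : Commute (A + c • 1) (Matrix.diagonal fun _ => -c) := by
    rw [← Matrix.smul_one_eq_diagonal]
    exact (Commute.one_right _).smul_right _
  rw [hsplit, Matrix.exp_add_of_commute _ _ hcomm, Matrix.exp_diagonal, Matrix.mul_diagonal]
  refine mul_nonneg (exp_nonneg_of_nonneg (fun x y => ?_) s s') ?_
  · rcases eq_or_ne x y with rfl | h
    · simpa using hc x
    · simpa [h] using hA x y h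
  · rw [Pi.coe_exp, ← Real.exp_eq_exp_ℝ]
    exact (Real.exp_pos _).le

/-- `A` kills the constant vector, so only the zeroth term of the exponential series contributes. -/
theorem sum_exp_apply {A : Matrix E E ℝ} (hA : ∀ s, ∑ s', A s s' = 0) (s : E) :
    ∑ s', NormedSpace.exp A s s' = 1 := by
  refine (hasSum_sum fun s' _ => hasSum_exp_apply A s s').unique ?_
  convert! hasSum_single (f := fun n : ℕ => ∑ s', ((n.factorial : ℝ)⁻¹ • A ^ n) s s') 0 ?_
  · simp [Matrix.one_apply]
  · intro n hn
    obtain ⟨n, rfl⟩ := Nat.exists_eq_succ_of_ne_zero hn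
    simp_rw [Matrix.smul_apply, smul_eq_mul, ← Finset.mul_sum, pow_succ, Matrix.mul_apply]
    rw [Finset.sum_comm]
    simp_rw [← Finset.mul_sum, hA]
    simp

open scoped Matrix.Norms.Operator in
theorem tendsto_exp_smul_sub_div (A : Matrix E E ℝ) (s s' : E) :
    Tendsto (fun u : ℝ≥0 =>
      (NormedSpace.exp ((u : ℝ) • A) s s' - if s = s' then 1 else 0) / (u : ℝ))
      (𝓝[>] 0) (𝓝 (A s s')) := by
  have h := (hasDerivAt_exp_smul_const (𝕂 := ℝ) A 0).tendsto_slope_zero_right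
  have h' := tendsto_pi_nhds.1 (tendsto_pi_nhds.1 h s) s'
  have hcoe : Tendsto (fun u : ℝ≥0 => (u : ℝ)) (𝓝[>] 0) (𝓝[>] 0) := by
    refine tendsto_nhdsWithin_iff.2 ⟨?_, ?_⟩
    · exact (NNReal.tendsto_coe.2 (tendsto_id (α := ℝ≥0) (x := 𝓝 0))).mono_left
        nhdsWithin_le_nhds
    · filter_upwards [self_mem_nhdsWithin] with u hu
      exact NNReal.coe_pos.2 hu
  have h'' := h'.comp hcoe
  simp only [zero_smul, NormedSpace.exp_zero, one_mul] at h''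
  refine h''.congr fun u => ?_
  simp [Matrix.one_apply, div_eq_inv_mul]
  exact Or.inl rfl

theorem isMarkovSemigroup_exp {A : Matrix E E ℝ} (hA : ∀ s s', s ≠ s' → 0 ≤ A s s')
    (hsum : ∀ s, ∑ s', A s s' = 0) :
    IsMarkovSemigroup fun u : ℝ≥0 => NormedSpace.exp ((u : ℝ) • A) where
  nonneg u := exp_nonneg_of_offDiag_nonneg fun s s' h =>
    mul_nonneg u.2 (hA s s' h)
  sum_row u := sum_exp_apply fun s => by
    simp_rw [Matrix.smul_apply, ← Finset.smul_sum, hsum, smul_zero]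
  add u v := by
    rw [NNReal.coe_add, add_smul, Matrix.exp_add_of_commute]
    exact ((Commute.refl A).smul_left _).smul_right _

end Exp

/-! ### Existence of the stationary chain and time reversibility -/

theorem HasUniformMarkovLaw.map_equiv {S : Type u} {S' : Type v} (e : S ≃ S') {Ω : Type w}
    [MeasurableSpace Ω] {μ : Measure Ω} {X : ℝ≥0 → Ω → S'} {P : ℝ≥0 → S → S → ℝ}
    (h : HasUniformMarkovLaw μ X fun u s s' => P u (e.symm s) (e.symm s')) :
    HasUniformMarkovLaw μ (fun u ω => e.symm (X u ω)) P := by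
  intro n t s ht
  simpa [e.symm_apply_eq, Nat.card_congr e] using h n t (fun i => e (s i)) ht

theorem exists_isCTMC_isStationary {S : Type u} [Finite S] [Nonempty S] {q : S → S → ℝ}
    (hq : ∀ s s', 0 ≤ q s s') (hsymm : ∀ s s', q s s' = q s' s) :
    ∃ (Ω : Type) (_ : MeasurableSpace Ω) (μ : Measure Ω) (X : ℝ≥0 → Ω → S),
      IsCTMC μ X q ∧ IsStationary μ X := by
  classical
  have := Fintype.ofFinite S
  -- `S` lives in an arbitrary universe while `Ω` must be in `Type`, so paths take values in `Fin
  -- (Nat.card S)` and are carried back to `S`.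
  set e := Finite.equivFin S
  have : Nonempty (Fin (Nat.card S)) := e.symm.nonempty
  set A : Matrix S S ℝ := Matrix.of (generator q)
  have hP := isMarkovSemigroup_exp (A := A) (fun s s' h =>
    (hq s s').trans_eq (generator_of_ne h).symm) sum_generator
  have hAsymm : A.IsSymm := Matrix.IsSymm.ext fun s s' => generator_comm hsymm s' s
  have hPsymm : ∀ (u : ℝ≥0) s s',
      NormedSpace.exp ((u : ℝ) • A) s s' = NormedSpace.exp ((u : ℝ) • A) s' s :=
    fun u s s' => (hAsymm.smul (u : ℝ)).exp.apply s' s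
  have hP' : IsMarkovSemigroup fun u : ℝ≥0 =>
      (NormedSpace.exp ((u : ℝ) • A)).submatrix e.symm e.symm :=
    { nonneg := fun u s s' => hP.nonneg u _ _
      sum_row := fun u s => (e.symm.sum_comp _).trans (hP.sum_row u _)
      add := fun u v => by
        rw [hP.add u v, Matrix.submatrix_mul_equiv] }
  obtain ⟨μ, hμ, hlaw⟩ := hP'.exists_hasUniformMarkovLaw fun u s' => by
    simp only [Matrix.submatrix_apply, hPsymm u _ (e.symm s')]
    exact (e.symm.sum_comp _).trans (hP.sum_row u _)
  have hlaw' := HasUniformMarkovLaw.map_equiv e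
    (P := fun u s s' => NormedSpace.exp ((u : ℝ) • A) s s') hlaw
  refine ⟨_, _, μ, _, hlaw'.isCTMC (fun t s => ?_) (fun s s' => ?_)
    (tendsto_exp_smul_sub_div A), hlaw'.isStationary⟩
  · simp_rw [e.symm_apply_eq]
    exact measurable_pi_apply t (measurableSet_singleton _)
  · simp [Matrix.one_apply]

theorem Irreducible.timeReversible {S : Type u} [Finite S] [Nonempty S] {q : S → S → ℝ}
    (hirr : Irreducible q) (hq : ∀ s s', 0 ≤ q s s') (hsymm : ∀ s s', q s s' = q s' s) :
    TimeReversible.{u, w} q :=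
  ⟨exists_isCTMC_isStationary hq hsymm,
    fun _ _ _ _ h hst => h.isReversible hst hirr hq hsymm⟩

end CTMC

theorem mainTheorem2 {Act : Type u} {Key : Type v} [Countable Act] [Countable Key]
    [Infinite Key] (bar : Act → RMPC.Rate → RMPC.Rate) (hbar : ∀ a r, bar a r = r)
    (R : RMPC.RProc Act Key) :
    Finite (RMPC.State bar R) ∧
    CTMC.Irreducible (RMPC.rate bar R) ∧
    (∃ p : RMPC.State bar R → ℝ,
      (∀ p', CTMC.IsSteadyState (RMPC.rate bar R) p' ↔ p' = p) ∧
      (∀ s, p s = 1 / (Nat.card (RMPC.State bar R) : ℝ)) ∧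
      (∀ s s', s ≠ s' → p s * CTMC.generator (RMPC.rate bar R) s s' =
        p s' * CTMC.generator (RMPC.rate bar R) s' s)) ∧
    CTMC.TimeReversible.{max u v, w} (RMPC.rate bar R) := by
  have hfin := RMPC.finite_state hbar R
  have hirr := RMPC.irreducible_rate hbar R
  have hq := RMPC.rate_nonneg (bar := bar) R
  have hsymm := RMPC.rate_comm hbar R
  have : Nonempty (RMPC.State bar R) := ⟨⟨RMPC.cls R, .refl⟩⟩
  exact ⟨hfin, hirr, ⟨fun _ => 1 / (Nat.card (RMPC.State bar R) : ℝ),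
    hirr.isSteadyState_iff hq hsymm, fun _ => rfl, fun s s' _ => by
      rw [CTMC.generator_comm hsymm]⟩, hirr.timeReversible hq hsymm⟩
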